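/- Let $\lambda_1,\lambda_2,\lambda_3\in\mathbb{C}$ and put $$F_1(x,t)=t_0(x_0^3+x_1^3+x_2^3)+t_1\,x_0x_1x_2,\qquad F_2(y,t)=(\lambda_1t_0+t_1)(y_0^3+y_1^3+y_2^3)+(\lambda_2t_0+\lambda_3t_1)\,y_0y_1y_2 .$$ Let $\widetilde X=\{([x],[t],[y])\mid F_1(x,t)=0=F_2(y,t)\}\subset\mathbb{P}^2\times\mathbb{P}^1\times\mathbb{P}^2$ (over $\mathbb{C}$, as a reduced complex analytic space), $B_1=\{F_1=0\}$ and $B_2=\{F_2=0\}$ in $\mathbb{P}^2\times\mathbb{P}^1$ (for generic parameters, $\widetilde X$ is a smooth Calabi–Yau threefold and $B_1,B_2$ are rational elliptic, or $dP_9$, surfaces), with projections $\pi_1([x],[t],[y])=([x],[t])$ and $\pi_2([x],[t],[y])=([y],[t])$ from $\widetilde X=B_1\times_{\mathbb{P}^1}B_2$ to $B_1$ and $B_2$. Let $\zeta=e^{2\pi i/3}$ and let $G=\mathbb{Z}_3\times\mathbb{Z}_3$ act on $\widetilde X$ through the generators $$g_1:\ [x_0:x_1:x_2]\mapsto[x_0:\zeta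 x_1:\zeta^2x_2],\quad [y_0:y_1:y_2]\mapsto[y_0:\zeta y_1:\zeta^2y_2],$$ $$g_2:\ [x_0:x_1:x_2]\mapsto[x_1:x_2:x_0],\quad [y_0:y_1:y_2]\mapsto[y_1:y_2:y_0],$$ both acting trivially on $[t_0:t_1]$. Let $t$ denote the divisor class on $B_i$ that is the pull-back of the hyperplane class of $\mathbb{P}^2$ under the projection (blow-up map) $B_i\to\mathbb{P}^2$, so that $\mathcal{O}_{B_i}(t)$ is the pull-back of $\mathcal{O}_{\mathbb{P}^2}(1)$. A holomorphic line bundle $\mathcal{L}$ on $\widetilde X$ is called $G$-invariant if $g^*\mathcal{L}\cong\mathcal{L}$ for every $g\in G$, and $G$-equivariant if the action of $G$ on $\widetilde X$ lifts to an action of $G$ on the total space of $\mathcal{L}$ by holomorphic maps that are linear on the fibers. Then for $i=1,2$ the holomorphic line bundle $\mathcal{O}_{\widetilde X}(\tau_i)=\mathcal{O}_{\widetilde X}(\pi_i^{-1}(t))=\pi_i^*\mathcal{O}_{B_i}(t)$ on $\widetilde X$ is $G$-invariant but not $G$-equivariant. -/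

import Mathlib

open scoped LinearAlgebra.Projectivization Topology
open Filter TopologicalSpace

noncomputable section

namespace Schoen

/-! ### Reduced complex analytic spaces and holomorphic maps -/

/-- A space with holomorphic functions: a topological space together with, for every point `x`,
the algebra of the functions that are holomorphic near `x`. Functions are total; only their
germ at `x` matters. -/
class HolSpace (X : Type) extends TopologicalSpace X where
  holAt : X → Subalgebra ℂ (X → ℂ)
  holAt_congr : ∀ {x : X} {f g : X → ℂ}, f =ᶠ[𝓝 x] g → f ∈ holAt x → g ∈ holAt x
  holAt_inv : ∀ {x : X} {f : X → ℂ}, f ∈ holAt x → f x ≠ 0 → f⁻¹ ∈ holAt x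

/-- The structure that a set `X` of points given by homogeneous coordinates inherits from its
cone `C` of coordinate vectors, `q : C → X` being the map to the point with the given
coordinates: the quotient topology, and a function is holomorphic near `x` if, near every
coordinate vector `v` of `x`, it is the restriction to `C` of a function of the coordinates which
is analytic at `v` in the ambient vector space. -/
abbrev HolSpace.ofCone {X E : Type} [NormedAddCommGroup E] [NormedSpace ℂ E] {C : Set E}
    (q : C → X) : HolSpace X :=
  letI : TopologicalSpace X := TopologicalSpace.coinduced q inferInstance
  { holAt := fun x =>
      { carrier := {f | ∀ v : C, q v = x →
          ∃ F : E → ℂ, AnalyticAt ℂ F v ∧ ∀ᶠ w : C in 𝓝 v, f (q w) = F w}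
        mul_mem' := by
          intro f g hf hg v hv
          obtain ⟨F, hF, hF'⟩ := hf v hv
          obtain ⟨G, hG, hG'⟩ := hg v hv
          refine ⟨F * G, hF.mul hG, ?_⟩
          filter_upwards [hF', hG'] with w h1 h2
          simp [h1, h2]
        add_mem' := by
          intro f g hf hg v hv
          obtain ⟨F, hF, hF'⟩ := hf v hv
          obtain ⟨G, hG, hG'⟩ := hg v hv
          refine ⟨F + G, hF.add hG, ?_⟩
          filter_upwards [hF', hG'] with w h1 h2
          simp [h1, h2]
        algebraMap_mem' := by
          intro c v _
          exact ⟨fun _ => c, analyticAt_const, Eventually.of_forall fun w => rfl⟩ }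
    holAt_congr := by
      intro x f g hfg hf v hv
      obtain ⟨F, hF, hF'⟩ := hf v hv
      refine ⟨F, hF, ?_⟩
      have hq : Continuous q := continuous_coinduced_rng
      have h2 := (hq.tendsto v).eventually (by rw [hv]; exact hfg)
      filter_upwards [hF', h2] with w h1 h2
      rw [← h2, h1]
    holAt_inv := by
      intro x f hf hx v hv
      obtain ⟨F, hF, hF'⟩ := hf v hv
      have h0 : F v ≠ 0 := by rw [← hF'.self_of_nhds, hv]; exact hx
      refine ⟨F⁻¹, hF.inv h0, ?_⟩
      filter_upwards [hF'] with w h1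
      simp [h1] }

/-- Holomorphic maps: continuous maps that pull holomorphic functions back to holomorphic
functions. -/
structure HolMap (X Y : Type) [HolSpace X] [HolSpace Y] where
  toFun : X → Y
  continuous : Continuous toFun
  hol_comp : ∀ (x : X) (f : Y → ℂ), f ∈ HolSpace.holAt (toFun x) → f ∘ toFun ∈ HolSpace.holAt x

/-- A map which is given by a holomorphic map of the homogeneous coordinates is holomorphic. -/
def HolMap.ofLift {X Y E E' : Type} [NormedAddCommGroup E] [NormedSpace ℂ E]
    [NormedAddCommGroup E'] [NormedSpace ℂ E'] {C : Set E} {C' : Set E'} (q : C → X) (q' : C' → Y)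
    (Φ : X → Y) (A : E → E') (hA : ∀ v, AnalyticAt ℂ A v) (hAC : ∀ v ∈ C, A v ∈ C')
    (hq : ∀ v : C, q' ⟨A v, hAC v v.2⟩ = Φ (q v)) :
    @HolMap X Y (HolSpace.ofCone q) (HolSpace.ofCone q') :=
  letI := HolSpace.ofCone q
  letI := HolSpace.ofCone q'
  have hc : Continuous fun v : C => (⟨A v, hAC v v.2⟩ : C') :=
    Continuous.subtype_mk
      ((continuous_iff_continuousAt.2 fun v => (hA v).continuousAt).comp continuous_subtype_val) _
  { toFun := Φ
    continuous := by
      refine continuous_coinduced_dom.2 ?_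
      have h' : Continuous q' := continuous_coinduced_rng
      exact (h'.comp hc).congr hq
    hol_comp := by
      intro x f hf v hv
      obtain ⟨F, hF, hF'⟩ := hf ⟨A v, hAC v v.2⟩ (by rw [hq, hv])
      refine ⟨F ∘ A, AnalyticAt.comp hF (hA v), ?_⟩
      filter_upwards [(hc.tendsto v).eventually hF'] with w hw
      simp only [Function.comp_apply, ← hq]
      exact hw }

/-- The identity map. -/
def HolMap.id (X : Type) [HolSpace X] : HolMap X X := ⟨fun x => x, continuous_id, fun _ _ h => h⟩

/-- Composition of holomorphic maps. -/
def HolMap.comp {X Y Z : Type} [HolSpace X] [HolSpace Y] [HolSpace Z]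
    (g : HolMap Y Z) (f : HolMap X Y) : HolMap X Z :=
  ⟨fun x => g.toFun (f.toFun x), g.continuous.comp f.continuous,
    fun x φ h => f.hol_comp x _ (g.hol_comp _ φ h)⟩

/-! ### Holomorphic line bundles -/

/-- A holomorphic line bundle: a family of complex lines `fiber x` with an atlas of local
trivializations `triv i`, defined on all of `X` for convenience, but isomorphisms only over the
open set `U i`, such that the transition functions are holomorphic. -/
structure LineBundle (X : Type) [HolSpace X] where
  fiber : X → Type
  [addCommGroup : ∀ x, AddCommGroup (fiber x)]
  [module : ∀ x, Module ℂ (fiber x)]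
  ι : Type
  U : ι → Set X
  isOpen_U : ∀ i, IsOpen (U i)
  cover : ∀ x, ∃ i, x ∈ U i
  triv : ∀ (_ : ι) (x : X), fiber x →ₗ[ℂ] ℂ
  bijective_triv : ∀ i, ∀ x ∈ U i, Function.Bijective (triv i x)
  hol_transition : ∀ i j, ∀ x ∈ U i ∩ U j, ∃ c ∈ HolSpace.holAt x,
    ∀ᶠ y in 𝓝 x, ∀ s : fiber y, triv j y s = c y * triv i y s

attribute [instance] LineBundle.addCommGroup LineBundle.module

/-- The pull-back of a holomorphic line bundle along a holomorphic map. -/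
def LineBundle.pullback {X Y : Type} [HolSpace X] [HolSpace Y] (L : LineBundle Y)
    (f : HolMap X Y) : LineBundle X where
  fiber x := L.fiber (f.toFun x)
  ι := L.ι
  U i := f.toFun ⁻¹' L.U i
  isOpen_U i := (L.isOpen_U i).preimage f.continuous
  cover x := L.cover _
  triv i x := L.triv i (f.toFun x)
  bijective_triv i x hx := L.bijective_triv i _ hx
  hol_transition i j x hx := by
    obtain ⟨c, hc, hc'⟩ := L.hol_transition i j _ hx
    exact ⟨c ∘ f.toFun, f.hol_comp x c hc, (f.continuous.tendsto x).eventually hc'⟩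

/-- A fibrewise linear isomorphism between line bundles is holomorphic if it is given by
multiplication with holomorphic functions in the local trivializations. -/
def IsHolIso {X : Type} [HolSpace X] (L M : LineBundle X)
    (φ : ∀ x, L.fiber x ≃ₗ[ℂ] M.fiber x) : Prop :=
  ∀ i j, ∀ x ∈ L.U i ∩ M.U j, ∃ c ∈ HolSpace.holAt x,
    ∀ᶠ y in 𝓝 x, ∀ s : L.fiber y, M.triv j y (φ y s) = c y * L.triv i y s

/-- Isomorphism of holomorphic line bundles. -/
def LineBundle.Isomorphic {X : Type} [HolSpace X] (L M : LineBundle X) : Prop :=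
  ∃ φ : ∀ x, L.fiber x ≃ₗ[ℂ] M.fiber x, IsHolIso L M φ

/-! ### Invariant and equivariant line bundles -/

/-- An action of a group by holomorphic automorphisms. -/
class HolAction (G : Type) [Group G] (X : Type) [HolSpace X] extends MulAction G X where
  smulHol : G → HolMap X X
  smulHol_apply : ∀ g x, (smulHol g).toFun x = g • x

/-- `L` is `G`-invariant: `g^* L` is isomorphic to `L` for each `g ∈ G`. -/
def LineBundle.IsInvariant (G : Type) [Group G] {X : Type} [HolSpace X] [HolAction G X]
    (L : LineBundle X) : Prop :=
  ∀ g : G, (L.pullback (HolAction.smulHol g)).Isomorphic L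

/-- A lift of the action of `G` on `X` to an action of `G` on the total space of `L` by holomorphic
maps which are linear on the fibres; `lift g x` is the resulting map from the fibre over `x` to
the fibre over `g • x`, and the equations `one` and `mul`, in the total space, say that this is
a group action. -/
structure EquivariantStructure (G : Type) [Group G] {X : Type} [HolSpace X] [HolAction G X]
    (L : LineBundle X) where
  lift : ∀ (g : G) (x : X), L.fiber x ≃ₗ[ℂ] L.fiber ((HolAction.smulHol g).toFun x)
  isHolIso : ∀ g, IsHolIso L (L.pullback (HolAction.smulHol g)) (lift g)
  one : ∀ (x : X) (s : L.fiber x),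
    (⟨(HolAction.smulHol (1 : G)).toFun x, lift 1 x s⟩ : Σ y, L.fiber y) = ⟨x, s⟩
  mul : ∀ (g h : G) (x : X) (s : L.fiber x),
    (⟨(HolAction.smulHol (g * h)).toFun x, lift (g * h) x s⟩ : Σ y, L.fiber y) =
      ⟨(HolAction.smulHol g).toFun ((HolAction.smulHol h).toFun x),
        lift g ((HolAction.smulHol h).toFun x) (lift h x s)⟩

/-- `L` is `G`-equivariant: the action of `G` on `X` lifts to `L`. -/
def LineBundle.IsEquivariant (G : Type) [Group G] {X : Type} [HolSpace X] [HolAction G X]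
    (L : LineBundle X) : Prop :=
  Nonempty (EquivariantStructure G L)

/-! ### The projective plane and the hyperplane bundle -/

/-- The complex projective line. -/
abbrev P1 : Type := ℙ ℂ (Fin 2 → ℂ)

/-- The complex projective plane. -/
abbrev P2 : Type := ℙ ℂ (Fin 3 → ℂ)

/-- The coordinate vectors of the points of the projective plane. -/
def P2.cone : Set (Fin 3 → ℂ) := {v | v ≠ 0}

/-- The point with given homogeneous coordinates. -/
def P2.proj (v : P2.cone) : P2 := Projectivization.mk ℂ v.1 v.2

instance : HolSpace P2 := HolSpace.ofCone P2.proj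

theorem rep_mk {n : ℕ} (v : Fin n → ℂ) (hv : v ≠ 0) :
    ∃ a : ℂ, a ≠ 0 ∧ (Projectivization.mk ℂ v hv).rep = a • v := by
  obtain ⟨a, ha⟩ := Projectivization.exists_smul_eq_mk_rep ℂ v hv
  exact ⟨a, a.ne_zero, ha.symm⟩

theorem rep_mem (p : P2) : p.rep ∈ p.submodule := by
  rw [Projectivization.submodule_eq]
  exact Submodule.mem_span_singleton_self _

theorem isOpen_rep_ne (i : Fin 3) : IsOpen {p : P2 | p.rep i ≠ 0} := by
  have h : IsOpen (P2.proj ⁻¹' {p : P2 | p.rep i ≠ 0}) := by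
    have e : P2.proj ⁻¹' {p : P2 | p.rep i ≠ 0} = {v : P2.cone | v.1 i ≠ 0} := by
      ext v
      obtain ⟨a, ha, h⟩ := rep_mk v.1 v.2
      simp [P2.proj, h, ha]
    rw [e]
    exact isOpen_ne_fun ((continuous_apply i).comp continuous_subtype_val) continuous_const
  exact isOpen_coinduced.2 h

/-- The hyperplane bundle `𝒪(1)` on the projective plane: its fibre over `p` is the dual of the
line in `ℂ³` that corresponds to `p`, and, where `x_i ≠ 0`, a functional on this line
is identified with its value at the vector of the line with `i`-th coordinate `1`. -/
def hyperplaneBundle : LineBundle P2 where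
  fiber p := Module.Dual ℂ p.submodule
  ι := Fin 3
  U i := {p | p.rep i ≠ 0}
  isOpen_U := isOpen_rep_ne
  cover p := Function.ne_iff.1 p.rep_nonzero
  triv i p :=
    Module.Dual.eval ℂ p.submodule
      ⟨(p.rep i)⁻¹ • p.rep, p.submodule.smul_mem _ (rep_mem p)⟩
  bijective_triv i p hp := by
    have hne : (⟨(p.rep i)⁻¹ • p.rep, p.submodule.smul_mem _ (rep_mem p)⟩ : p.submodule) ≠ 0 := by
      intro h
      have := congrArg Subtype.val h
      simp only [ZeroMemClass.coe_zero, smul_eq_zero, inv_eq_zero] at this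
      exact this.elim hp p.rep_nonzero
    have hr : Module.finrank ℂ (Module.Dual ℂ p.submodule) = Module.finrank ℂ ℂ := by
      rw [Subspace.dual_finrank_eq, Projectivization.finrank_submodule, Module.finrank_self]
    have hi : Function.Injective (Module.Dual.eval ℂ p.submodule
        ⟨(p.rep i)⁻¹ • p.rep, p.submodule.smul_mem _ (rep_mem p)⟩) := by
      rw [injective_iff_map_eq_zero]
      intro φ hφ
      ext w
      obtain ⟨c, hc⟩ :=
        (finrank_eq_one_iff_of_nonzero' _ hne).1 (Projectivization.finrank_submodule p) w
      rw [← hc, map_smul]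
      change c • φ _ = 0
      rw [Module.Dual.eval_apply] at hφ
      rw [hφ, smul_zero]
    exact ⟨hi, (LinearMap.injective_iff_surjective_of_finrank_eq_finrank hr).1 hi⟩
  hol_transition i j p hp := by
    refine ⟨fun y => y.rep i / y.rep j, ?_, ?_⟩
    · intro v hv
      obtain ⟨a, ha, h⟩ := rep_mk v.1 v.2
      have hj : v.1 j ≠ 0 := by
        have := hp.2
        rw [← hv] at this
        intro h0
        exact this (by simp [P2.proj, h, h0])
      refine ⟨fun w => w i / w j, ?_, Eventually.of_forall fun w => ?_⟩
      · exact (ContinuousLinearMap.proj (R := ℂ) (φ := fun _ : Fin 3 => ℂ) i).analyticAt _ |>.div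
          ((ContinuousLinearMap.proj (R := ℂ) (φ := fun _ : Fin 3 => ℂ) j).analyticAt _) hj
      · obtain ⟨b, hb, h⟩ := rep_mk w.1 w.2
        simp only [P2.proj, h, Pi.smul_apply, smul_eq_mul]
        exact mul_div_mul_left _ _ hb
    · filter_upwards [(isOpen_rep_ne i).mem_nhds hp.1] with y hy s
      have e : ∀ k, Module.Dual.eval ℂ y.submodule
          ⟨(y.rep k)⁻¹ • y.rep, y.submodule.smul_mem _ (rep_mem y)⟩ s
          = (y.rep k)⁻¹ * s ⟨y.rep, rep_mem y⟩ := by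
        intro k
        rw [Module.Dual.eval_apply, ← smul_eq_mul, ← map_smul]
        rfl
      rw [e, e]
      have hy' : y.rep i ≠ 0 := hy
      field_simp

/-! ### The rational elliptic surfaces and the threefold -/

/-- `ζ = exp (2πi/3)`. -/
def ζ : ℂ := Complex.exp (2 * Real.pi * Complex.I / 3)

theorem zeta_pow_three : ζ ^ 3 = 1 := by
  rw [ζ, ← Complex.exp_nat_mul]
  have : ((3 : ℕ) : ℂ) * (2 * Real.pi * Complex.I / 3) = 2 * Real.pi * Complex.I := by
    push_cast; ring
  rw [this, Complex.exp_two_pi_mul_I]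

/-- `[x₀ : x₁ : x₂] ↦ [x₀ : ζ x₁ : ζ² x₂]`, on coordinates. -/
def clock : (Fin 3 → ℂ) ≃ₗ[ℂ] (Fin 3 → ℂ) where
  toFun x := ![x 0, ζ * x 1, ζ ^ 2 * x 2]
  map_add' x y := by ext i; fin_cases i <;> simp <;> ring
  map_smul' a x := by ext i; fin_cases i <;> simp <;> ring
  invFun x := ![x 0, ζ ^ 2 * x 1, ζ * x 2]
  left_inv x := by
    ext i; fin_cases i
    · simp
    · simp; linear_combination (x 1) * zeta_pow_three
    · simp; linear_combination (x 2) * zeta_pow_three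
  right_inv x := by
    ext i; fin_cases i
    · simp
    · simp; linear_combination (x 1) * zeta_pow_three
    · simp; linear_combination (x 2) * zeta_pow_three

/-- `[x₀ : x₁ : x₂] ↦ [x₁ : x₂ : x₀]`, on coordinates. -/
def shift : (Fin 3 → ℂ) ≃ₗ[ℂ] (Fin 3 → ℂ) where
  toFun x := ![x 1, x 2, x 0]
  map_add' x y := by ext i; fin_cases i <;> simp
  map_smul' a x := by ext i; fin_cases i <;> simp
  invFun x := ![x 2, x 0, x 1]
  left_inv x := by ext i; fin_cases i <;> simp
  right_inv x := by ext i; fin_cases i <;> simp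

/-- The first defining polynomial. -/
def F₁ (x : Fin 3 → ℂ) (t : Fin 2 → ℂ) : ℂ :=
  t 0 * (x 0 ^ 3 + x 1 ^ 3 + x 2 ^ 3) + t 1 * (x 0 * x 1 * x 2)

/-- The second defining polynomial, with parameters `l₁`, `l₂`, `l₃`. -/
def F₂ (l₁ l₂ l₃ : ℂ) (y : Fin 3 → ℂ) (t : Fin 2 → ℂ) : ℂ :=
  (l₁ * t 0 + t 1) * (y 0 ^ 3 + y 1 ^ 3 + y 2 ^ 3) + (l₂ * t 0 + l₃ * t 1) * (y 0 * y 1 * y 2)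

/-- The properties of `F₁` and `F₂` which the constructions below use, proved for both of them
right below: they are homogeneous of degree `(3, 1)` and invariant under the two symmetries. -/
class InvariantForm (F : (Fin 3 → ℂ) → (Fin 2 → ℂ) → ℂ) : Prop where
  smul : ∀ (a b : ℂ) (x : Fin 3 → ℂ) (t : Fin 2 → ℂ), F (a • x) (b • t) = a ^ 3 * b * F x t
  clock : ∀ x t, F (clock x) t = F x t
  shift : ∀ x t, F (shift x) t = F x t

instance : InvariantForm F₁ where
  smul a b x t := by simp [F₁]; ring
  clock x t := by
    simp [F₁, clock]
    linear_combination (t 0 * (x 1 ^ 3 + (ζ ^ 3 + 1) * x 2 ^ 3) + t 1 * (x 0 * x 1 * x 2)) *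
      zeta_pow_three
  shift x t := by simp [F₁, shift]; ring

instance (l₁ l₂ l₃ : ℂ) : InvariantForm (F₂ l₁ l₂ l₃) where
  smul a b x t := by simp [F₂]; ring
  clock x t := by
    simp [F₂, clock]
    linear_combination ((l₁ * t 0 + t 1) * (x 1 ^ 3 + (ζ ^ 3 + 1) * x 2 ^ 3) +
      (l₂ * t 0 + l₃ * t 1) * (x 0 * x 1 * x 2)) * zeta_pow_three
  shift x t := by simp [F₂, shift]; ring

section

variable (F F' : (Fin 3 → ℂ) → (Fin 2 → ℂ) → ℂ)

/-- Whether a homogeneous polynomial vanishes does not depend on the homogeneous coordinates. -/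
theorem vanish_mk_iff [InvariantForm F] {x : Fin 3 → ℂ} (hx : x ≠ 0) {t : Fin 2 → ℂ}
    (ht : t ≠ 0) :
    F (Projectivization.mk ℂ x hx).rep (Projectivization.mk ℂ t ht).rep = 0 ↔ F x t = 0 := by
  obtain ⟨a, ha, h⟩ := rep_mk x hx
  obtain ⟨b, hb, h'⟩ := rep_mk t ht
  rw [h, h', InvariantForm.smul (F := F)]
  simp [ha, hb]

/-- The hypersurface `F = 0` in `ℙ² × ℙ¹`. -/
def Surface : Type := {z : P2 × P1 // F z.1.rep z.2.rep = 0}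

/-- The bihomogeneous coordinates of the points of the surface. -/
def Surface.cone : Set ((Fin 3 → ℂ) × (Fin 2 → ℂ)) := {v | v.1 ≠ 0 ∧ v.2 ≠ 0 ∧ F v.1 v.2 = 0}

/-- The point with given coordinates. -/
def Surface.proj [InvariantForm F] (v : Surface.cone F) : Surface F :=
  ⟨(Projectivization.mk ℂ v.1.1 v.2.1, Projectivization.mk ℂ v.1.2 v.2.2.1),
    (vanish_mk_iff F _ _).2 v.2.2.2⟩

instance [InvariantForm F] : HolSpace (Surface F) := HolSpace.ofCone (Surface.proj F)

/-- The complete intersection `F(x, t) = 0`, `F'(y, t) = 0` in `ℙ² × ℙ¹ × ℙ²`, that is, the fibre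
product over `ℙ¹` of the surfaces `F = 0` and `F' = 0`. -/
def Threefold : Type :=
  {z : P2 × P1 × P2 // F z.1.rep z.2.1.rep = 0 ∧ F' z.2.2.rep z.2.1.rep = 0}

/-- The multihomogeneous coordinates of the points of the threefold. -/
def Threefold.cone : Set ((Fin 3 → ℂ) × (Fin 2 → ℂ) × (Fin 3 → ℂ)) :=
  {v | v.1 ≠ 0 ∧ v.2.1 ≠ 0 ∧ v.2.2 ≠ 0 ∧ F v.1 v.2.1 = 0 ∧ F' v.2.2 v.2.1 = 0}

variable [InvariantForm F] [InvariantForm F']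

/-- The point with given coordinates. -/
def Threefold.proj (v : Threefold.cone F F') : Threefold F F' :=
  ⟨(Projectivization.mk ℂ v.1.1 v.2.1, Projectivization.mk ℂ v.1.2.1 v.2.2.1,
      Projectivization.mk ℂ v.1.2.2 v.2.2.2.1),
    (vanish_mk_iff F _ _).2 v.2.2.2.2.1, (vanish_mk_iff F' _ _).2 v.2.2.2.2.2⟩

instance : HolSpace (Threefold F F') := HolSpace.ofCone (Threefold.proj F F')

/-- The projection `[x], [t] ↦ [x]` of the surface to the plane: the blow-up of the nine base
points of a pencil of cubics. -/
def Surface.toPlane : HolMap (Surface F) P2 :=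
  HolMap.ofLift (Surface.proj F) P2.proj (fun z => z.1.1) (fun v => v.1)
    (fun _ => analyticAt_fst) (fun _ hv => hv.1) (fun _ => rfl)

/-- The projection `([x], [t], [y]) ↦ ([x], [t])`. -/
def Threefold.π₁ : HolMap (Threefold F F') (Surface F) :=
  HolMap.ofLift (Threefold.proj F F') (Surface.proj F)
    (fun z => ⟨(z.1.1, z.1.2.1), z.2.1⟩) (fun v => (v.1, v.2.1))
    (fun _ => analyticAt_fst.prod (analyticAt_fst.comp analyticAt_snd))
    (fun _ hv => ⟨hv.1, hv.2.1, hv.2.2.2.1⟩) (fun _ => rfl)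

/-- The projection `([x], [t], [y]) ↦ ([y], [t])`. -/
def Threefold.π₂ : HolMap (Threefold F F') (Surface F') :=
  HolMap.ofLift (Threefold.proj F F') (Surface.proj F')
    (fun z => ⟨(z.1.2.2, z.1.2.1), z.2.2⟩) (fun v => (v.2.2, v.2.1))
    (fun _ => (analyticAt_snd.comp analyticAt_snd).prod (analyticAt_fst.comp analyticAt_snd))
    (fun _ hv => ⟨hv.2.2.1, hv.2.1, hv.2.2.2.2⟩) (fun _ => rfl)

variable {F F'}

theorem vanish_map (A : (Fin 3 → ℂ) ≃ₗ[ℂ] (Fin 3 → ℂ)) (hA : ∀ x t, F (A x) t = F x t)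
    (p : P2) (t : P1) (h : F p.rep t.rep = 0) :
    F (Projectivization.map A.toLinearMap A.injective p).rep t.rep = 0 := by
  have e : Projectivization.map A.toLinearMap A.injective p =
      Projectivization.mk ℂ (A p.rep) (A.map_ne_zero_iff.2 p.rep_nonzero) := by
    conv_lhs => rw [← p.mk_rep]
    rfl
  have h2 := (vanish_mk_iff F (A.map_ne_zero_iff.2 p.rep_nonzero) t.rep_nonzero).2
    (by rw [hA]; exact h)
  rwa [t.mk_rep, ← e] at h2

/-- The automorphism `([x], [t], [y]) ↦ ([A x], [t], [A y])` for a linear map `A` which leaves the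
defining polynomials invariant. -/
def Threefold.auto (A : (Fin 3 → ℂ) ≃ₗ[ℂ] (Fin 3 → ℂ)) (hA : ∀ x t, F (A x) t = F x t)
    (hA' : ∀ x t, F' (A x) t = F' x t) : HolMap (Threefold F F') (Threefold F F') :=
  HolMap.ofLift (Threefold.proj F F') (Threefold.proj F F')
    (fun z => ⟨(Projectivization.map A.toLinearMap A.injective z.1.1, z.1.2.1,
        Projectivization.map A.toLinearMap A.injective z.1.2.2),
      vanish_map A hA _ _ z.2.1, vanish_map A hA' _ _ z.2.2⟩)
    (fun v => (A v.1, v.2.1, A v.2.2))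
    (fun v =>
      have hL := fun w => (A.toLinearMap.toContinuousLinearMap).analyticAt w
      ((hL v.1).comp analyticAt_fst).prod
        ((analyticAt_fst.comp analyticAt_snd).prod
          (AnalyticAt.comp (hL v.2.2) (analyticAt_snd.comp analyticAt_snd))))
    (fun _ hv => ⟨A.map_ne_zero_iff.2 hv.1, hv.2.1, A.map_ne_zero_iff.2 hv.2.2.1,
      (hA _ _).trans hv.2.2.2.1, (hA' _ _).trans hv.2.2.2.2⟩)
    (fun _ => rfl)

variable (F F')

/-- The generator `g₁` of the group action. -/
def Threefold.g₁ : HolMap (Threefold F F') (Threefold F F') :=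
  Threefold.auto clock InvariantForm.clock InvariantForm.clock

/-- The generator `g₂` of the group action. -/
def Threefold.g₂ : HolMap (Threefold F F') (Threefold F F') :=
  Threefold.auto shift InvariantForm.shift InvariantForm.shift

theorem Threefold.g₁_cube (z : Threefold F F') : (Threefold.g₁ F F').toFun^[3] z = z := by
  have h : ∀ p : P2, (Projectivization.map clock.toLinearMap clock.injective)^[3] p = p := by
    intro p
    induction p using Projectivization.ind with | h v hv =>
    refine (Projectivization.mk_eq_mk_iff' ℂ _ _ _ _).2 ⟨1, ?_⟩
    ext i; fin_cases i
    · simp [clock]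
    · simp [clock]; linear_combination -(v 1) * zeta_pow_three
    · simp [clock]; linear_combination -(v 2) * (ζ ^ 3 + 1) * zeta_pow_three
  exact Subtype.ext (Prod.ext (h _) (Prod.ext rfl (h _)))

theorem Threefold.g₂_cube (z : Threefold F F') : (Threefold.g₂ F F').toFun^[3] z = z := by
  have h : ∀ p : P2, (Projectivization.map shift.toLinearMap shift.injective)^[3] p = p := by
    intro p
    induction p using Projectivization.ind with | h v hv =>
    refine (Projectivization.mk_eq_mk_iff' ℂ _ _ _ _).2 ⟨1, ?_⟩
    ext i; fin_cases i <;> simp [shift]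
  exact Subtype.ext (Prod.ext (h _) (Prod.ext rfl (h _)))

theorem Threefold.g_comm :
    Function.Commute (Threefold.g₁ F F').toFun (Threefold.g₂ F F').toFun := by
  have h : ∀ p : P2, Projectivization.map clock.toLinearMap clock.injective
        (Projectivization.map shift.toLinearMap shift.injective p) =
      Projectivization.map shift.toLinearMap shift.injective
        (Projectivization.map clock.toLinearMap clock.injective p) := by
    intro p
    induction p using Projectivization.ind with | h v hv =>
    refine (Projectivization.mk_eq_mk_iff' ℂ _ _ _ _).2 ⟨ζ ^ 2, ?_⟩
    ext i; fin_cases i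
    · simp [clock, shift]; linear_combination (v 1) * zeta_pow_three
    · simp [clock, shift]; linear_combination (v 2) * ζ * zeta_pow_three
    · simp [clock, shift]
  exact fun z => Subtype.ext (Prod.ext (h _) (Prod.ext rfl (h _)))

/-- The iterates of a holomorphic map. -/
def HolMap.iter {X : Type} [HolSpace X] (f : HolMap X X) : ℕ → HolMap X X
  | 0 => HolMap.id X
  | n + 1 => (HolMap.iter f n).comp f

theorem HolMap.iter_apply {X : Type} [HolSpace X] (f : HolMap X X) (n : ℕ) (x : X) :
    (f.iter n).toFun x = f.toFun^[n] x := by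
  induction n generalizing x with
  | zero => rfl
  | succ n ih => exact ih _

theorem iterate_val_add {X : Type} {f : X → X} (h : ∀ x, f^[3] x = x) (a b : ZMod 3) (x : X) :
    f^[(a + b).val] x = f^[a.val] (f^[b.val] x) := by
  rw [ZMod.val_add, ← Function.iterate_add_apply]
  exact Function.IsPeriodicPt.iterate_mod_apply (h x) _

/-- The group `ℤ/3 × ℤ/3`, written multiplicatively. -/
abbrev G : Type := Multiplicative (ZMod 3 × ZMod 3)

/-- The action in which `(a, b)` acts as `g₁ᵃ g₂ᵇ`. -/
instance : HolAction G (Threefold F F') where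
  smul g z := (((Threefold.g₁ F F').iter g.toAdd.1.val).comp
    ((Threefold.g₂ F F').iter g.toAdd.2.val)).toFun z
  one_smul z := rfl
  mul_smul g h z := by
    change ((Threefold.g₁ F F').iter (g.toAdd.1 + h.toAdd.1).val).toFun
        (((Threefold.g₂ F F').iter (g.toAdd.2 + h.toAdd.2).val).toFun z) =
      ((Threefold.g₁ F F').iter g.toAdd.1.val).toFun
        (((Threefold.g₂ F F').iter g.toAdd.2.val).toFun
          (((Threefold.g₁ F F').iter h.toAdd.1.val).toFun
            (((Threefold.g₂ F F').iter h.toAdd.2.val).toFun z)))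
    simp only [HolMap.iter_apply]
    rw [iterate_val_add (Threefold.g₁_cube F F'), iterate_val_add (Threefold.g₂_cube F F')]
    congr 1
    exact (Threefold.g_comm F F').iterate_iterate _ _ _
  smulHol g := ((Threefold.g₁ F F').iter g.toAdd.1.val).comp
    ((Threefold.g₂ F F').iter g.toAdd.2.val)
  smulHol_apply _ _ := rfl

/-- The line bundle `𝒪_B(t)` on the surface `B`, where `t` is the class of the pull-back of a line
under the blow-up map from `B` to the plane. -/
def Surface.bundleT : LineBundle (Surface F) := hyperplaneBundle.pullback (Surface.toPlane F)

end

/-- The first rational elliptic surface, `F₁ = 0` in `ℙ² × ℙ¹`. -/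
abbrev B₁ : Type := Surface F₁

/-- The second rational elliptic surface (for `l₂ ≠ l₁ l₃`), `F₂ = 0` in `ℙ² × ℙ¹`. -/
abbrev B₂ (l₁ l₂ l₃ : ℂ) : Type := Surface (F₂ l₁ l₂ l₃)

/-- The threefold `X̃`, given by `F₁(x, t) = 0` and `F₂(y, t) = 0` in `ℙ² × ℙ¹ × ℙ²`. -/
abbrev Xt (l₁ l₂ l₃ : ℂ) : Type := Threefold F₁ (F₂ l₁ l₂ l₃)

/-- The projection `π₁ : X̃ → B₁`. -/
def π₁ (l₁ l₂ l₃ : ℂ) : HolMap (Xt l₁ l₂ l₃) B₁ := Threefold.π₁ F₁ (F₂ l₁ l₂ l₃)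

/-- The projection `π₂ : X̃ → B₂`. -/
def π₂ (l₁ l₂ l₃ : ℂ) : HolMap (Xt l₁ l₂ l₃) (B₂ l₁ l₂ l₃) := Threefold.π₂ F₁ (F₂ l₁ l₂ l₃)

/-- The line bundle `𝒪(τ₁) = π₁^* 𝒪_{B₁}(t)`. -/
def bundleTau₁ (l₁ l₂ l₃ : ℂ) : LineBundle (Xt l₁ l₂ l₃) :=
  (Surface.bundleT F₁).pullback (π₁ l₁ l₂ l₃)

/-- The line bundle `𝒪(τ₂) = π₂^* 𝒪_{B₂}(t)`. -/
def bundleTau₂ (l₁ l₂ l₃ : ℂ) : LineBundle (Xt l₁ l₂ l₃) :=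
  (Surface.bundleT (F₂ l₁ l₂ l₃)).pullback (π₂ l₁ l₂ l₃)

end Schoen

end

noncomputable section

namespace Schoen

/-! ### Linear maps of the plane and the hyperplane bundle -/

/-! Both bundles are pull-backs of `hyperplaneBundle` along a map to the plane that intertwines the
generators with `clock` and `shift`. A linear automorphism of `ℂ³` acts on the tautological lines,
hence on their duals, which gives invariance (`isomorphic_pullback_hyperplaneBundle`).

The obstruction to equivariance is that `clock` and `shift` commute only up to `ζ ^ 2`
(`clock_shift`). A lift of a generator is the linear one times a nowhere vanishing global
holomorphic function (`exists_multiplier`). If these functions take the same value at some point `z`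
and at its two images, they cancel when the two lifts are commuted at `z`, leaving `ζ ^ 2 = 1`
(`not_isEquivariant_pullback`).

For arbitrary parameters the threefold may be singular, so constancy of global functions is not
taken from general theory. Only one point and its two images matter, and explicit chains of rational
curves join them (`eq_of_isBasePoint`); Liouville's theorem makes a global function constant along
each curve. -/

theorem hyperplaneBundle_apply_eq {p : P2} {j : Fin 3} (hj : p.rep j ≠ 0) {w : Fin 3 → ℂ}
    (hw : w ∈ p.submodule) (s : Module.Dual ℂ p.submodule) :
    s ⟨w, hw⟩ = w j * hyperplaneBundle.triv j p s := by
  obtain ⟨a, rfl⟩ : ∃ a : ℂ, a • p.rep = w := by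
    rwa [Projectivization.submodule_eq, Submodule.mem_span_singleton] at hw
  change _ = _ * s ⟨(p.rep j)⁻¹ • p.rep, p.submodule.smul_mem _ (rep_mem p)⟩
  rw [← smul_eq_mul, ← map_smul]
  congr 1
  ext1
  simp only [SetLike.mk_smul_mk, Pi.smul_apply, smul_eq_mul, smul_smul]
  rw [mul_assoc, mul_inv_cancel₀ hj, mul_one]

/-- Supplies a nonzero value to cancel when scalar multipliers are compared. -/
theorem exists_dual_rep_ne_zero (p : P2) :
    ∃ s : Module.Dual ℂ p.submodule, s ⟨p.rep, rep_mem p⟩ ≠ 0 := by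
  by_contra! h
  refine p.rep_nonzero (congrArg Subtype.val ((Module.forall_dual_apply_eq_zero_iff ℂ _).1 h))

/-- Ratios of linear forms are holomorphic functions on the plane. -/
theorem ratio_mem_holAt (A : (Fin 3 → ℂ) ≃ₗ[ℂ] (Fin 3 → ℂ)) (i j : Fin 3) {p : P2}
    (hp : p.rep i ≠ 0) : (fun y : P2 => A y.rep j / y.rep i) ∈ HolSpace.holAt p := by
  rintro v rfl
  obtain ⟨a, ha, h⟩ := rep_mk v.1 v.2
  have hi : v.1 i ≠ 0 := fun h0 => hp (by simp [P2.proj, h, h0])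
  refine ⟨fun w => A w j / w i, ?_, Eventually.of_forall fun w => ?_⟩
  · exact ((ContinuousLinearMap.proj (R := ℂ) (φ := fun _ : Fin 3 => ℂ) j).comp
      A.toLinearMap.toContinuousLinearMap).analyticAt _ |>.div
        ((ContinuousLinearMap.proj (R := ℂ) (φ := fun _ : Fin 3 => ℂ) i).analyticAt _) hi
  · obtain ⟨b, hb, h⟩ := rep_mk w.1 w.2
    simp only [P2.proj, h, map_smul, Pi.smul_apply, smul_eq_mul]
    exact mul_div_mul_left _ _ hb

/-- A linear map which carries the lines of `f` to the lines of `f'` identifies the pull-backs of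
the hyperplane bundle along `f'` and `f`. -/
theorem isomorphic_pullback_hyperplaneBundle {X : Type} [HolSpace X] (f f' : HolMap X P2)
    (A : (Fin 3 → ℂ) ≃ₗ[ℂ] (Fin 3 → ℂ))
    (hA : ∀ x, (f.toFun x).submodule.map (A : (Fin 3 → ℂ) →ₗ[ℂ] (Fin 3 → ℂ)) =
      (f'.toFun x).submodule) :
    (hyperplaneBundle.pullback f').Isomorphic (hyperplaneBundle.pullback f) := by
  -- Dualizing reverses the direction: `A` carries lines of `f` to lines of `f'`, so functionals
  -- pull back from `f'` to `f`.
  refine ⟨fun x => (LinearEquiv.ofSubmodules A _ _ (hA x)).dualMap, ?_⟩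
  rintro (i : Fin 3) (j : Fin 3) x ⟨hi, hj⟩
  refine ⟨(fun y : P2 => A y.rep i / y.rep j) ∘ f.toFun,
    f.hol_comp x _ (ratio_mem_holAt A j i hj), ?_⟩
  filter_upwards [((isOpen_rep_ne i).preimage f'.continuous).mem_nhds hi] with y hy s
  have hmem : A (((f.toFun y).rep j)⁻¹ • (f.toFun y).rep) ∈ (f'.toFun y).submodule := by
    rw [← hA]
    exact Submodule.mem_map_of_mem (Submodule.smul_mem _ _ (rep_mem _))
  have h := hyperplaneBundle_apply_eq hy hmem s
  refine h.trans ?_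
  simp only [map_smul, Pi.smul_apply, smul_eq_mul, Function.comp_apply]
  rw [div_eq_inv_mul]
  rfl

/-- An isomorphism from the pull-back of the hyperplane bundle along `f` to the one along `f'`
differs from the one induced by a linear map by a nowhere vanishing holomorphic function. -/
theorem exists_multiplier {X : Type} [HolSpace X] (f f' : HolMap X P2)
    (A : (Fin 3 → ℂ) ≃ₗ[ℂ] (Fin 3 → ℂ))
    (hA : ∀ x, (f.toFun x).submodule.map (A : (Fin 3 → ℂ) →ₗ[ℂ] (Fin 3 → ℂ)) =
      (f'.toFun x).submodule)
    (φ : ∀ x, Module.Dual ℂ (f.toFun x).submodule ≃ₗ[ℂ] Module.Dual ℂ (f'.toFun x).submodule)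
    (hφ : IsHolIso (hyperplaneBundle.pullback f) (hyperplaneBundle.pullback f') φ) :
    ∃ h : X → ℂ, (∀ x, h ∈ HolSpace.holAt x) ∧ (∀ x, h x ≠ 0) ∧
      ∀ x s v (hv : v ∈ (f.toFun x).submodule) (hv' : A v ∈ (f'.toFun x).submodule),
        φ x s ⟨A v, hv'⟩ = h x * s ⟨v, hv⟩ := by
  have hmem : ∀ {x v}, v ∈ (f.toFun x).submodule → A v ∈ (f'.toFun x).submodule := by
    intro x v hv
    rw [← hA]
    exact Submodule.mem_map_of_mem hv
  have local_multiplier : ∀ x, ∃ k ∈ HolSpace.holAt x, ∀ᶠ y in 𝓝 x,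
      ∀ s v (hv : v ∈ (f.toFun y).submodule), φ y s ⟨A v, hmem hv⟩ = k y * s ⟨v, hv⟩ := by
    intro x
    obtain ⟨i, hi⟩ : ∃ i : Fin 3, (f.toFun x).rep i ≠ 0 := hyperplaneBundle.cover _
    obtain ⟨j, hj⟩ : ∃ j : Fin 3, (f'.toFun x).rep j ≠ 0 := hyperplaneBundle.cover _
    obtain ⟨c, hc, hc'⟩ := hφ i j x ⟨hi, hj⟩
    -- For `v = a • rep`, evaluation at `A v` contributes `a * (A rep) j` and evaluation at `v`
    -- contributes `a * rep i`; the quotient corrects the factor `c` of the trivializations.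
    refine ⟨c * ((fun y : P2 => A y.rep j / y.rep i) ∘ f.toFun),
      Subalgebra.mul_mem _ hc (f.hol_comp x _ (ratio_mem_holAt A i j hi)), ?_⟩
    filter_upwards [hc', ((isOpen_rep_ne i).preimage f.continuous).mem_nhds hi,
      ((isOpen_rep_ne j).preimage f'.continuous).mem_nhds hj] with y hy hyi hyj s v hv
    have hyi' : (f.toFun y).rep i ≠ 0 := hyi
    rw [hyperplaneBundle_apply_eq hyi hv, hyperplaneBundle_apply_eq hyj (hmem hv)]
    have e : hyperplaneBundle.triv j (f'.toFun y) (φ y s) =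
        c y * hyperplaneBundle.triv i (f.toFun y) s := hy s
    rw [e]
    obtain ⟨a, rfl⟩ : ∃ a : ℂ, a • (f.toFun y).rep = v := by
      rwa [Projectivization.submodule_eq, Submodule.mem_span_singleton] at hv
    simp only [map_smul, Pi.smul_apply, smul_eq_mul, Pi.mul_apply, Function.comp_apply]
    field_simp
  choose k hk hk' using local_multiplier
  have key : ∀ x s v (hv : v ∈ (f.toFun x).submodule),
      φ x s ⟨A v, hmem hv⟩ = k x x * s ⟨v, hv⟩ := fun x => (hk' x).self_of_nhds
  refine ⟨fun x => k x x, fun x => ?_, fun x h0 => ?_, fun x s v hv _ => key x s v hv⟩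
  -- The multiplier at `y` is determined by `φ y`, so the local choices agree and glue: near `x` the
  -- diagonal function equals `k x`.
  · refine HolSpace.holAt_congr ?_ (hk x)
    filter_upwards [hk' x] with y hy
    obtain ⟨s, hs⟩ := exists_dual_rep_ne_zero (f.toFun y)
    exact mul_right_cancel₀ hs ((hy s _ (rep_mem _)).symm.trans (key y s _ (rep_mem _)))
  · obtain ⟨s, hs⟩ := exists_dual_rep_ne_zero (f.toFun x)
    -- Every vector of the target line has the form `A v`, so a zero of the multiplier would make `φ
    -- x` vanish, against injectivity.
    have hs0 : φ x s = 0 := by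
      ext ⟨w, hw⟩
      have hw' := hw
      rw [← hA] at hw'
      obtain ⟨v, hv, rfl⟩ := hw'
      refine (key x s v hv).trans ?_
      simp only [h0, zero_mul, LinearMap.zero_apply]
    rw [(φ x).map_eq_zero_iff.1 hs0] at hs
    exact hs rfl

/-- If two commuting elements of the group act through linear maps of the plane which commute only
up to a scalar `ω ≠ 1`, and global holomorphic functions do not separate some point from its
images, then the pull-back of the hyperplane bundle is not equivariant. -/
theorem not_isEquivariant_pullback {H X : Type} [CommGroup H] [HolSpace X] [HolAction H X]
    (f : HolMap X P2) (g g' : H) (A A' : (Fin 3 → ℂ) ≃ₗ[ℂ] (Fin 3 → ℂ))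
    (hA : ∀ x, (f.toFun x).submodule.map (A : (Fin 3 → ℂ) →ₗ[ℂ] (Fin 3 → ℂ)) =
      (f.toFun ((HolAction.smulHol g).toFun x)).submodule)
    (hA' : ∀ x, (f.toFun x).submodule.map (A' : (Fin 3 → ℂ) →ₗ[ℂ] (Fin 3 → ℂ)) =
      (f.toFun ((HolAction.smulHol g').toFun x)).submodule)
    (ω : ℂ) (hω : ω ≠ 1) (hcomm : ∀ v, A (A' v) = ω • A' (A v)) (z : X)
    (hz : ∀ h : X → ℂ, (∀ x, h ∈ HolSpace.holAt x) →
      h ((HolAction.smulHol g).toFun z) = h z ∧ h ((HolAction.smulHol g').toFun z) = h z) :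
    ¬ (hyperplaneBundle.pullback f).IsEquivariant H := by
  rintro ⟨E⟩
  obtain ⟨h, hh, h0, hE⟩ := exists_multiplier f (f.comp (HolAction.smulHol g)) A hA
    (E.lift g) (E.isHolIso g)
  obtain ⟨h', hh', h0', hE'⟩ := exists_multiplier f (f.comp (HolAction.smulHol g')) A' hA'
    (E.lift g') (E.isHolIso g')
  have mem : ∀ {x v}, v ∈ (f.toFun x).submodule →
      A v ∈ (f.toFun ((HolAction.smulHol g).toFun x)).submodule := fun {x v} hv =>
    hA x ▸ Submodule.mem_map_of_mem hv
  have mem' : ∀ {x v}, v ∈ (f.toFun x).submodule →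
      A' v ∈ (f.toFun ((HolAction.smulHol g').toFun x)).submodule := fun {x v} hv =>
    hA' x ▸ Submodule.mem_map_of_mem hv
  obtain ⟨s, hs⟩ := exists_dual_rep_ne_zero (f.toFun z)
  set v := (f.toFun z).rep
  have hv : v ∈ (f.toFun z).submodule := rep_mem _
  -- The two composite lifts lie in fibres over points that are equal but not syntactically so.
  -- Evaluating at one fixed vector of `ℂ³` turns their equality in the total space into an equality
  -- of numbers; the default `0` never occurs below.
  let ev : (Σ y, (hyperplaneBundle.pullback f).fiber y) → ℂ := by
    classical
    exact fun t => if ht : A (A' v) ∈ (f.toFun t.1).submodule then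
      (show Module.Dual ℂ (f.toFun t.1).submodule from t.2) ⟨A (A' v), ht⟩ else 0
  have ev_mk : ∀ y (t : Module.Dual ℂ (f.toFun y).submodule)
      (ht : A (A' v) ∈ (f.toFun y).submodule), ev ⟨y, t⟩ = t ⟨A (A' v), ht⟩ :=
    fun y t ht => dif_pos ht
  have e := E.mul g g' z s
  rw [mul_comm, E.mul g' g z s] at e
  have ht : A (A' v) ∈ (f.toFun ((HolAction.smulHol g').toFun
      ((HolAction.smulHol g).toFun z))).submodule := by
    rw [hcomm]
    exact Submodule.smul_mem _ _ (mem' (mem hv))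
  have e2 := (ev_mk _ _ ht).symm.trans ((congrArg ev e).trans (ev_mk _ _ (mem (mem' hv))))
  have e3 := (hE _ (E.lift g' z s) _ (mem' hv) (mem (mem' hv))).trans
    (congrArg₂ (· * ·) (hz h hh).2 (hE' z s v hv (mem' hv)))
  have e4 := (hE' _ (E.lift g z s) _ (mem hv) (mem' (mem hv))).trans
    (congrArg₂ (· * ·) (hz h' hh').1 (hE z s v hv (mem hv)))
  have e5 : (⟨A (A' v), ht⟩ : (f.toFun ((HolAction.smulHol g').toFun
      ((HolAction.smulHol g).toFun z))).submodule) = ω • ⟨A' (A v), mem' (mem hv)⟩ :=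
    Subtype.ext (hcomm v)
  have e6 := ((LinearMap.map_smul _ ω _).symm.trans (congrArg _ e5.symm)).trans (e2.trans e3)
  have e7 : ω * (h' z * (h z * s ⟨v, hv⟩)) = h z * (h' z * s ⟨v, hv⟩) :=
    (congrArg (ω * ·) e4).symm.trans e6
  have hne : h z * (h' z * s ⟨v, hv⟩) ≠ 0 := mul_ne_zero (h0 z) (mul_ne_zero (h0' z) hs)
  refine hω (mul_right_cancel₀ hne ?_)
  linear_combination e7

/-! ### Holomorphic functions and lines on the threefold -/

/-- Liouville's theorem on the projective line: a function on the line which is entire in both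
standard charts takes the same value at the two centres. -/
theorem eq_of_entire_of_eq_inv {f g : ℂ → ℂ} (hf : Differentiable ℂ f) (hg : Differentiable ℂ g)
    (h : ∀ u, u ≠ 0 → f u = g u⁻¹) : f 0 = g 0 := by
  -- The line is covered by the closed unit discs of its two charts, and both images are compact.
  have hb : Bornology.IsBounded (Set.range f) := by
    have hK : IsCompact (Metric.closedBall (0 : ℂ) 1) := isCompact_closedBall 0 1
    refine ((hK.image hf.continuous).isBounded.union
      (hK.image hg.continuous).isBounded).subset ?_
    rintro _ ⟨u, rfl⟩
    rcases le_total ‖u‖ 1 with hu | hu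
    · exact Or.inl ⟨u, by simpa using hu, rfl⟩
    · have h0 : u ≠ 0 := norm_pos_iff.1 (by linarith)
      refine Or.inr ⟨u⁻¹, ?_, (h u h0).symm⟩
      simpa using inv_le_one_of_one_le₀ hu
  have hconst : ∀ u, f u = f 0 := fun u => hf.apply_eq_apply_of_bounded hb u 0
  have hg' : Set.EqOn g (fun _ => f 0) {0}ᶜ := fun u hu => by
    change g u = f 0
    rw [← hconst u⁻¹, h u⁻¹ (inv_ne_zero hu), inv_inv]
  exact (congrFun (hg.continuous.ext_on (dense_compl_singleton 0) continuous_const hg') 0).symm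

section

variable {F F' : (Fin 3 → ℂ) → (Fin 2 → ℂ) → ℂ} [InvariantForm F] [InvariantForm F']

/-- The maps `c` and `c'` are coordinate lifts of one rational curve in its two charts, glued by `u
↦ u⁻¹`. Locally `h` is an analytic function of the ambient coordinates, so it becomes entire in each
chart, whether or not the threefold is smooth along the curve. -/
theorem Threefold.eq_of_rational_curve {h : Threefold F F' → ℂ}
    (hh : ∀ z, h ∈ HolSpace.holAt z) (c c' : ℂ → (Fin 3 → ℂ) × (Fin 2 → ℂ) × (Fin 3 → ℂ))
    (hc : Differentiable ℂ c) (hc' : Differentiable ℂ c')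
    (hm : ∀ u, c u ∈ Threefold.cone F F') (hm' : ∀ u, c' u ∈ Threefold.cone F F')
    (he : ∀ u, u ≠ 0 → Threefold.proj F F' ⟨c u, hm u⟩ = Threefold.proj F F' ⟨c' u⁻¹, hm' u⁻¹⟩) :
    h (Threefold.proj F F' ⟨c 0, hm 0⟩) = h (Threefold.proj F F' ⟨c' 0, hm' 0⟩) := by
  have diff : ∀ (d : ℂ → (Fin 3 → ℂ) × (Fin 2 → ℂ) × (Fin 3 → ℂ)), Differentiable ℂ d →
      ∀ hd : ∀ u, d u ∈ Threefold.cone F F',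
        Differentiable ℂ fun u => h (Threefold.proj F F' ⟨d u, hd u⟩) := by
    intro d hd hdm u
    obtain ⟨K, hK, hK'⟩ := hh (Threefold.proj F F' ⟨d u, hdm u⟩) ⟨d u, hdm u⟩ rfl
    have hcont : Continuous fun u => (⟨d u, hdm u⟩ : Threefold.cone F F') :=
      hd.continuous.subtype_mk _
    exact (hK.differentiableAt.comp u (hd u)).congr_of_eventuallyEq
      ((hcont.tendsto u).eventually hK')
  exact eq_of_entire_of_eq_inv (diff c hc hm) (diff c' hc' hm') fun u hu =>
    congrArg h (he u hu)

theorem mk_add_smul_eq {n : ℕ} (a b : Fin n → ℂ) {u : ℂ} (hu : u ≠ 0) (h : a + u • b ≠ 0)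
    (h' : b + u⁻¹ • a ≠ 0) :
    Projectivization.mk ℂ (a + u • b) h = Projectivization.mk ℂ (b + u⁻¹ • a) h' := by
  refine (Projectivization.mk_eq_mk_iff' ℂ _ _ _ _).2 ⟨u, ?_⟩
  rw [smul_add, smul_smul, mul_inv_cancel₀ hu, one_smul, add_comm]

/-- A global holomorphic function is constant on a line in the direction of the first factor. -/
theorem Threefold.eq_of_line_fst {h : Threefold F F' → ℂ} (hh : ∀ z, h ∈ HolSpace.holAt z)
    {x x' : Fin 3 → ℂ} {t : Fin 2 → ℂ} {y : Fin 3 → ℂ} (hx : ∀ u : ℂ, x + u • x' ≠ 0)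
    (hx' : ∀ u : ℂ, x' + u • x ≠ 0) (hF : ∀ a b : ℂ, F (a • x + b • x') t = 0)
    (hm : (x, t, y) ∈ Threefold.cone F F') (hm' : (x', t, y) ∈ Threefold.cone F F') :
    h (Threefold.proj F F' ⟨_, hm⟩) = h (Threefold.proj F F' ⟨_, hm'⟩) := by
  have key := Threefold.eq_of_rational_curve hh (fun u => (x + u • x', t, y))
    (fun u => (x' + u • x, t, y)) (by fun_prop) (by fun_prop)
    (fun u => ⟨hx u, hm.2.1, hm.2.2.1, by simpa using hF 1 u, hm.2.2.2.2⟩)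
    (fun u => ⟨hx' u, hm.2.1, hm.2.2.1, by simpa [add_comm] using hF u 1, hm.2.2.2.2⟩)
    (fun u hu => Subtype.ext (Prod.ext (mk_add_smul_eq x x' hu _ _) rfl))
  simpa using key

/-- A global holomorphic function is constant on a line in the direction of the parameter. -/
theorem Threefold.eq_of_line_param {h : Threefold F F' → ℂ} (hh : ∀ z, h ∈ HolSpace.holAt z)
    {x : Fin 3 → ℂ} {t t' : Fin 2 → ℂ} {y : Fin 3 → ℂ} (ht : ∀ u : ℂ, t + u • t' ≠ 0)
    (ht' : ∀ u : ℂ, t' + u • t ≠ 0) (hF : ∀ r, F x r = 0) (hF' : ∀ r, F' y r = 0)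
    (hm : (x, t, y) ∈ Threefold.cone F F') (hm' : (x, t', y) ∈ Threefold.cone F F') :
    h (Threefold.proj F F' ⟨_, hm⟩) = h (Threefold.proj F F' ⟨_, hm'⟩) := by
  have key := Threefold.eq_of_rational_curve hh (fun u => (x, t + u • t', y))
    (fun u => (x, t' + u • t, y)) (by fun_prop) (by fun_prop)
    (fun u => ⟨hm.1, ht u, hm.2.2.1, hF _, hF' _⟩)
    (fun u => ⟨hm.1, ht' u, hm.2.2.1, hF _, hF' _⟩)
    (fun u hu => Subtype.ext (Prod.ext rfl (Prod.ext (mk_add_smul_eq t t' hu _ _) rfl)))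
  simpa using key

/-- A global holomorphic function is constant on a line in the direction of the last factor. -/
theorem Threefold.eq_of_line_snd {h : Threefold F F' → ℂ} (hh : ∀ z, h ∈ HolSpace.holAt z)
    {x : Fin 3 → ℂ} {t : Fin 2 → ℂ} {y y' : Fin 3 → ℂ} (hy : ∀ u : ℂ, y + u • y' ≠ 0)
    (hy' : ∀ u : ℂ, y' + u • y ≠ 0) (hF : ∀ a b : ℂ, F' (a • y + b • y') t = 0)
    (hm : (x, t, y) ∈ Threefold.cone F F') (hm' : (x, t, y') ∈ Threefold.cone F F') :
    h (Threefold.proj F F' ⟨_, hm⟩) = h (Threefold.proj F F' ⟨_, hm'⟩) := by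
  have key := Threefold.eq_of_rational_curve hh (fun u => (x, t, y + u • y'))
    (fun u => (x, t, y' + u • y)) (by fun_prop) (by fun_prop)
    (fun u => ⟨hm.1, hm.2.1, hy u, hm.2.2.2.1, by simpa using hF 1 u⟩)
    (fun u => ⟨hm.1, hm.2.1, hy' u, hm.2.2.2.1, by simpa [add_comm] using hF u 1⟩)
    (fun u hu => Subtype.ext (Prod.ext rfl (Prod.ext rfl (mk_add_smul_eq y y' hu _ _))))
  simpa using key

end

/-! ### The base points of the two pencils of cubics -/

/-- The vertex `[1 : 0 : 0]` of the triangle `x₀ x₁ x₂ = 0`. -/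
def vertex : Fin 3 → ℂ := ![1, 0, 0]

/-- Coordinates of the base points of the pencils which lie on the two edges through the vertex. -/
structure IsBasePoint (b : Fin 3 → ℂ) : Prop where
  cubes : b 0 ^ 3 + b 1 ^ 3 + b 2 ^ 3 = 0
  edge : b 1 * b 2 = 0
  ne_vertex : b 1 ≠ 0 ∨ b 2 ≠ 0

namespace IsBasePoint

variable {b : Fin 3 → ℂ} (hb : IsBasePoint b)
include hb

theorem ne_zero : b ≠ 0 := by
  rintro rfl
  simpa using hb.ne_vertex

/-- Both pencils are spanned by the Fermat cubic and the triangle, so they share their base points.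
-/
theorem F₁_eq_zero (t : Fin 2 → ℂ) : F₁ b t = 0 := by
  simp only [F₁]
  linear_combination t 0 * hb.cubes + t 1 * b 0 * hb.edge

theorem F₂_eq_zero (l₁ l₂ l₃ : ℂ) (t : Fin 2 → ℂ) : F₂ l₁ l₂ l₃ b t = 0 := by
  simp only [F₂]
  linear_combination (l₁ * t 0 + t 1) * hb.cubes + (l₂ * t 0 + l₃ * t 1) * b 0 * hb.edge

/-- `ne_vertex` makes `b` and `vertex` linearly independent, so neither chart of the line joining
them meets the origin. -/
theorem add_smul_vertex_ne_zero (u : ℂ) : b + u • vertex ≠ 0 := by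
  intro h
  have h1 := congrFun h 1
  have h2 := congrFun h 2
  simp [vertex] at h1 h2
  exact hb.ne_vertex.elim (· h1) (· h2)

theorem vertex_add_smul_ne_zero (u : ℂ) : vertex + u • b ≠ 0 := by
  intro h
  have h0 := congrFun h 0
  have h1 := congrFun h 1
  have h2 := congrFun h 2
  simp [vertex] at h0 h1 h2
  rcases hb.ne_vertex with hn | hn
  · simp [h1.resolve_right hn] at h0
  · simp [h2.resolve_right hn] at h0

end IsBasePoint

/-- This point and its `clock` image lie on the edge `x₂ = 0`, its `shift` image on `x₁ = 0`. Both
edges pass through `vertex`, so one vertex serves all three points. -/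
theorem isBasePoint_self : IsBasePoint ![1, -1, 0] where
  cubes := by simp; norm_num
  edge := by simp
  ne_vertex := by simp

theorem isBasePoint_clock : IsBasePoint (clock ![1, -1, 0]) where
  cubes := by simp [clock]; linear_combination -zeta_pow_three
  edge := by simp [clock]
  ne_vertex := by
    have : ζ ≠ 0 := Complex.exp_ne_zero _
    simp [clock, this]

theorem isBasePoint_shift : IsBasePoint (shift ![1, -1, 0]) where
  cubes := by simp [shift]; norm_num
  edge := by simp [shift]
  ne_vertex := by simp [shift]

section

variable (l₁ l₂ l₃ : ℂ)

theorem IsBasePoint.mem_cone {b b' : Fin 3 → ℂ} (hb : IsBasePoint b) (hb' : IsBasePoint b')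
    {t : Fin 2 → ℂ} (ht : t ≠ 0) : (b, t, b') ∈ Threefold.cone F₁ (F₂ l₁ l₂ l₃) :=
  ⟨hb.ne_zero, ht, hb'.ne_zero, hb.F₁_eq_zero t, hb'.F₂_eq_zero l₁ l₂ l₃ t⟩

theorem vertex_ne_zero : vertex ≠ 0 := fun h => by simpa [vertex] using congrFun h 0

theorem infinity_ne_zero : (![0, 1] : Fin 2 → ℂ) ≠ 0 := fun h => by simpa using congrFun h 1

/-- Global holomorphic functions on `X̃` do not separate the points `(b, ∞, b)`, for base points
`b`: these points are joined by chains of edges of the triangles in the two pencils and of lines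
`{b} × ℙ¹ × {b'}`. -/
theorem eq_of_isBasePoint {h : Xt l₁ l₂ l₃ → ℂ} (hh : ∀ z, h ∈ HolSpace.holAt z)
    {b b' : Fin 3 → ℂ} (hb : IsBasePoint b) (hb' : IsBasePoint b') :
    h (Threefold.proj _ _ ⟨_, hb.mem_cone l₁ l₂ l₃ hb infinity_ne_zero⟩) =
      h (Threefold.proj _ _ ⟨_, hb'.mem_cone l₁ l₂ l₃ hb' infinity_ne_zero⟩) := by
  -- At this parameter the Fermat coefficient `l₁ t₀ + t₁` of `F₂` vanishes, so the edges of the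
  -- triangle lie in the second fibre, even when `l₂ = l₁ l₃` and that fibre is the whole plane.
  have ht : (![1, -l₁] : Fin 2 → ℂ) ≠ 0 := fun h => by simpa using congrFun h 0
  -- At `[0 : 1]` the form `F₁` is `x₀x₁x₂`, so the first coordinate may slide along an edge to the
  -- vertex.
  have first : ∀ {a c : Fin 3 → ℂ} (ha : IsBasePoint a) (hc : IsBasePoint c),
      h (Threefold.proj _ _ ⟨_, ha.mem_cone l₁ l₂ l₃ hc infinity_ne_zero⟩) =
        h (Threefold.proj _ _ ⟨(vertex, ![0, 1], c), vertex_ne_zero, infinity_ne_zero,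
          hc.ne_zero, by simp [F₁, vertex], hc.F₂_eq_zero l₁ l₂ l₃ _⟩) := by
    intro a c ha hc
    refine Threefold.eq_of_line_fst hh ha.add_smul_vertex_ne_zero ha.vertex_add_smul_ne_zero
      (fun r s => ?_) _ _
    simp [F₁, vertex]
    have := mul_eq_zero.1 ha.edge
    tauto
  have last : ∀ {a c : Fin 3 → ℂ} (ha : IsBasePoint a) (hc : IsBasePoint c),
      h (Threefold.proj _ _ ⟨_, ha.mem_cone l₁ l₂ l₃ hc ht⟩) =
        h (Threefold.proj _ _ ⟨(a, ![1, -l₁], vertex), ha.ne_zero, ht, vertex_ne_zero,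
          ha.F₁_eq_zero _, by simp [F₂, vertex]⟩) := by
    intro a c ha hc
    refine Threefold.eq_of_line_snd hh hc.add_smul_vertex_ne_zero hc.vertex_add_smul_ne_zero
      (fun r s => ?_) _ _
    simp [F₂, vertex]
    have := mul_eq_zero.1 hc.edge
    tauto
  have param : ∀ {a c : Fin 3 → ℂ} (ha : IsBasePoint a) (hc : IsBasePoint c),
      h (Threefold.proj _ _ ⟨_, ha.mem_cone l₁ l₂ l₃ hc infinity_ne_zero⟩) =
        h (Threefold.proj _ _ ⟨_, ha.mem_cone l₁ l₂ l₃ hc ht⟩) := by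
    intro a c ha hc
    refine Threefold.eq_of_line_param hh (fun u h0 => ?_) (fun u h0 => ?_) ha.F₁_eq_zero
      (hc.F₂_eq_zero l₁ l₂ l₃) _ _
    · have h1 := congrFun h0 0
      have h2 := congrFun h0 1
      simp at h1 h2
      simp [h1] at h2
    · simpa using congrFun h0 0
  -- With `s = [1 : -l₁]`, the chain is `(b, ∞, b)`, `(b', ∞, b)`, `(b', s, b)`, `(b', s, b')`,
  -- `(b', ∞, b')`; both moves between base points pass through `vertex`.
  rw [(first hb hb).trans (first hb' hb).symm, param hb' hb,
    (last hb' hb).trans (last hb' hb').symm, param hb' hb']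

end

/-! ### The action on the two plane factors -/

theorem submodule_map (A : (Fin 3 → ℂ) ≃ₗ[ℂ] (Fin 3 → ℂ)) (p : P2) :
    p.submodule.map (A : (Fin 3 → ℂ) →ₗ[ℂ] (Fin 3 → ℂ)) =
      (Projectivization.map A.toLinearMap A.injective p).submodule := by
  induction p using Projectivization.ind with | h v hv =>
  rw [Projectivization.map_mk, Projectivization.submodule_mk, Projectivization.submodule_mk,
    Submodule.map_span, Set.image_singleton]

/-- Invariance concerns all of `G`, whose elements act by iterates of the generators; only the
existence of some linear lift is needed. -/
theorem HolMap.exists_linear_iter {X : Type} [HolSpace X] {f : X → P2} {φ : HolMap X X}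
    {A : (Fin 3 → ℂ) ≃ₗ[ℂ] (Fin 3 → ℂ)}
    (hA : ∀ x, (f x).submodule.map (A : (Fin 3 → ℂ) →ₗ[ℂ] (Fin 3 → ℂ)) =
      (f (φ.toFun x)).submodule) (n : ℕ) :
    ∃ B : (Fin 3 → ℂ) ≃ₗ[ℂ] (Fin 3 → ℂ),
      ∀ x, (f x).submodule.map (B : (Fin 3 → ℂ) →ₗ[ℂ] (Fin 3 → ℂ)) =
        (f ((φ.iter n).toFun x)).submodule := by
  induction n with
  | zero => exact ⟨LinearEquiv.refl ℂ _, fun x => Submodule.map_id _⟩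
  | succ n ih =>
    obtain ⟨B, hB⟩ := ih
    refine ⟨A.trans B, fun x => ?_⟩
    rw [LinearEquiv.coe_trans, Submodule.map_comp, hA, hB]
    rfl

/-- The Heisenberg relation: the action on the plane comes from a projective representation of `G`,
and this scalar is the obstruction. -/
theorem clock_shift (v : Fin 3 → ℂ) : clock (shift v) = ζ ^ 2 • shift (clock v) := by
  ext i; fin_cases i
  · simp [clock, shift]; linear_combination -(v 1) * zeta_pow_three
  · simp [clock, shift]; linear_combination -(v 2) * ζ * zeta_pow_three
  · simp [clock, shift]

theorem zeta_sq_ne_one : ζ ^ 2 ≠ 1 := by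
  have h : IsPrimitiveRoot ζ 3 := by
    simpa [ζ] using Complex.isPrimitiveRoot_exp 3 (by norm_num)
  exact h.pow_ne_one_of_pos_of_lt (by norm_num) (by norm_num)

theorem isInvariant_and_not_isEquivariant (l₁ l₂ l₃ : ℂ) (f : HolMap (Xt l₁ l₂ l₃) P2)
    (hc : ∀ z, (f.toFun z).submodule.map (clock : (Fin 3 → ℂ) →ₗ[ℂ] (Fin 3 → ℂ)) =
      (f.toFun ((Threefold.g₁ F₁ (F₂ l₁ l₂ l₃)).toFun z)).submodule)
    (hs : ∀ z, (f.toFun z).submodule.map (shift : (Fin 3 → ℂ) →ₗ[ℂ] (Fin 3 → ℂ)) =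
      (f.toFun ((Threefold.g₂ F₁ (F₂ l₁ l₂ l₃)).toFun z)).submodule) :
    (hyperplaneBundle.pullback f).IsInvariant G ∧
      ¬ (hyperplaneBundle.pullback f).IsEquivariant G := by
  constructor
  · intro g
    obtain ⟨A, hA⟩ := HolMap.exists_linear_iter hc g.toAdd.1.val
    obtain ⟨B, hB⟩ := HolMap.exists_linear_iter hs g.toAdd.2.val
    refine isomorphic_pullback_hyperplaneBundle f (f.comp (HolAction.smulHol g)) (B.trans A)
      fun x => ?_
    rw [LinearEquiv.coe_trans, Submodule.map_comp, hB, hA]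
    rfl
  · refine not_isEquivariant_pullback f (Multiplicative.ofAdd ((1, 0) : ZMod 3 × ZMod 3))
      (Multiplicative.ofAdd ((0, 1) : ZMod 3 × ZMod 3)) clock shift hc hs (ζ ^ 2) zeta_sq_ne_one
      clock_shift (Threefold.proj _ _
        ⟨_, isBasePoint_self.mem_cone l₁ l₂ l₃ isBasePoint_self infinity_ne_zero⟩)
      fun h hh => ⟨?_, ?_⟩
    -- The image of the chosen point under the generator is, by unfolding, the point with
    -- coordinates `clock b`, `∞`, `clock b`.
    · exact eq_of_isBasePoint l₁ l₂ l₃ hh isBasePoint_clock isBasePoint_self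
    · exact eq_of_isBasePoint l₁ l₂ l₃ hh isBasePoint_shift isBasePoint_self

end Schoen

end

theorem mainTheorem4 (l₁ l₂ l₃ : ℂ) :
    ((Schoen.bundleTau₁ l₁ l₂ l₃).IsInvariant Schoen.G ∧
      ¬ (Schoen.bundleTau₁ l₁ l₂ l₃).IsEquivariant Schoen.G) ∧
    ((Schoen.bundleTau₂ l₁ l₂ l₃).IsInvariant Schoen.G ∧
      ¬ (Schoen.bundleTau₂ l₁ l₂ l₃).IsEquivariant Schoen.G) :=
  -- The iterated pull-back defining each bundle is by definition the pull-back along the composite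
  -- map to the plane.
  ⟨Schoen.isInvariant_and_not_isEquivariant l₁ l₂ l₃
      ((Schoen.Surface.toPlane _).comp (Schoen.π₁ l₁ l₂ l₃))
      (fun _ => Schoen.submodule_map _ _) (fun _ => Schoen.submodule_map _ _),
    Schoen.isInvariant_and_not_isEquivariant l₁ l₂ l₃
      ((Schoen.Surface.toPlane _).comp (Schoen.π₂ l₁ l₂ l₃))
      (fun _ => Schoen.submodule_map _ _) (fun _ => Schoen.submodule_map _ _)⟩
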